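/- Let $x(t)$, $t\in\mathbb{R}$, be a (real- or complex-valued) zero-mean wide sense stationary process with variance $\sigma_x^2=\mathbb{E}|x(t)|^2>0$ and power spectral density $S_x$, i.e. $S_x\ge 0$ is an integrable function with $\mathbb{E}[x(t+\tau)\overline{x(t)}]=\int_{\mathbb{R}} S_x(f)e^{2\pi i f\tau}\,df$ for all $t,\tau$. Suppose that $x$ is bandlimited to $f_m$, i.e. $S_x(f)=0$ for all $|f|>f_m$, and that it is sampled uniformly with sampling frequency $f_s=1/T_s>0$ satisfying the Nyquist condition $f_s\ge 2f_m$. For a square-integrable linear reconstruction filter $G$ (real-valued if $x$ is real-valued, complex-valued otherwise) such that the symmetric partial sums of $$\hat{x}(t)=\sum_{k\in\mathbb{Z}}G(t-kT_s)\,x(kT_s)$$ converge in mean square for every $t$, let $$\zeta=\frac{1}{\sigma_x^2T_s}\int_0^{T_s}\mathbb{E}|x(t)-\hat{x}(t)|^2\,dt$$ be its normalized mean-squared error (NMSE). Then the minimum of $\zeta$ over all such filters $G$ exists and equals $0$. Moreover, the spectral expression for the minimal NMSE also vanishes: $$1-\frac{1}{\sigma_x^2}\sum_{k\in\mathbb{Z}}\int_{-f_s/2}^{f_s/2}\frac{|S_x(f-kf_s)|^2}{\sum_{k'\in\mathbb{Z}}S_x(f-k'f_s)}\,df=0$$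 (with $0/0=0$). More precisely, for all $|f|<f_s/2$ one has $S_x(f-kf_s)=0$ for every integer $k\neq 0$, so that only the terms $k=k'=0$ survive, and $\int_{-f_s/2}^{f_s/2}|S_x(f)|^2/S_x(f)\,df=\sigma_x^2$. -/

import Mathlib

open MeasureTheory Filter Topology Set
open scoped ENNReal FourierTransform ComplexConjugate

/-- A scalar of `𝕜 = ℝ` or `𝕜 = ℂ`, seen as a complex number. -/
noncomputable def scalarToComplex {𝕜 : Type*} [RCLike 𝕜] (z : 𝕜) : ℂ :=
  (RCLike.re z : ℂ) + (RCLike.im z : ℂ) * Complex.I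

/-- The correlation `E[x(t) conj (x(s))]` of a (real or complex) stochastic process. -/
noncomputable def correlation {𝕜 Ω : Type*} [RCLike 𝕜] [MeasurableSpace Ω] (P : Measure Ω)
    (x : ℝ → Ω → 𝕜) (t s : ℝ) : 𝕜 :=
  ∫ ω, x t ω * conj (x s ω) ∂P

/-- `x` is a zero-mean wide sense stationary process: finite second moments, zero mean, and
a correlation that depends on the time difference only. -/
structure IsZeroMeanWSS {𝕜 Ω : Type*} [RCLike 𝕜] [MeasurableSpace Ω] (P : Measure Ω)
    (x : ℝ → Ω → 𝕜) : Prop where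
  memLp : ∀ t, MemLp (x t) 2 P
  mean_zero : ∀ t, ∫ ω, x t ω ∂P = 0
  stationary : ∀ t s τ, correlation P x (t + τ) t = correlation P x (s + τ) s

/-- The variance `σ_x² = E|x(0)|²` of a zero-mean WSS process. -/
noncomputable def signalVariance {𝕜 Ω : Type*} [RCLike 𝕜] [MeasurableSpace Ω] (P : Measure Ω)
    (x : ℝ → Ω → 𝕜) : ℝ :=
  ∫ ω, ‖x 0 ω‖ ^ 2 ∂P

/-- `S` is the power spectral density of the WSS process `x`: a nonnegative integrable function
whose inverse Fourier transform `τ ↦ ∫ S(f) exp(2πi f τ) df` is the autocorrelation function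
`τ ↦ E[x(τ) conj (x(0))]`. -/
structure IsPSD {𝕜 Ω : Type*} [RCLike 𝕜] [MeasurableSpace Ω] (P : Measure Ω)
    (x : ℝ → Ω → 𝕜) (S : ℝ → ℝ) : Prop where
  nonneg : ∀ f, 0 ≤ S f
  integrable : Integrable S volume
  autocorrelation_eq : ∀ τ, scalarToComplex (correlation P x τ 0) = 𝓕⁻ (fun f => (S f : ℂ)) τ

/-- The spectrum `S` is bandlimited to the maximal frequency `fm`. -/
def IsBandlimited (S : ℝ → ℝ) (fm : ℝ) : Prop :=
  ∀ f, fm < |f| → S f = 0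

/-- The truncated reconstruction `∑_{|k| ≤ N} G(t - k T) x(k T)`. -/
noncomputable def partialReconstruction {𝕜 Ω : Type*} [RCLike 𝕜] (x : ℝ → Ω → 𝕜) (T : ℝ)
    (G : ℝ → 𝕜) (N : ℕ) (t : ℝ) (ω : Ω) : 𝕜 :=
  ∑ k ∈ Finset.Icc (-(N : ℤ)) (N : ℤ), G (t - k * T) * x (k * T) ω

/-- `y(t) = ∑_{k ∈ ℤ} G(t - k T) x(k T)` is the output of the linear reconstruction filter `G`
(of finite energy) fed with the samples of `x` with sampling interval `T`; for every time `t`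
the series converges in the mean-square sense, as the limit of its symmetric partial sums. -/
structure IsLinearReconstruction {𝕜 Ω : Type*} [RCLike 𝕜] [MeasurableSpace Ω] (P : Measure Ω)
    (x : ℝ → Ω → 𝕜) (T : ℝ) (G : ℝ → 𝕜) (y : ℝ → Ω → 𝕜) : Prop where
  filter_memLp : MemLp G 2 volume
  output_memLp : ∀ t, MemLp (y t) 2 P
  tendsto : ∀ t, Tendsto
    (fun N : ℕ => ∫⁻ ω, ‖y t ω - partialReconstruction x T G N t ω‖ₑ ^ 2 ∂P) atTop (𝓝 0)

/-- The normalized mean-squared error `(σ_x² T)⁻¹ ∫_0^T E|x(t) - y(t)|² dt`, with values in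
`[0, ∞]`. -/
noncomputable def nmse {𝕜 Ω : Type*} [RCLike 𝕜] [MeasurableSpace Ω] (P : Measure Ω)
    (x : ℝ → Ω → 𝕜) (T : ℝ) (y : ℝ → Ω → 𝕜) : ℝ≥0∞ :=
  (∫⁻ t in Ioc 0 T, ∫⁻ ω, ‖x t ω - y t ω‖ₑ ^ 2 ∂P) / ENNReal.ofReal (signalVariance P x * T)

/-- The set of all NMSEs that linear reconstruction filters achieve from the samples of `x` with
sampling interval `T`. -/
def achievableNMSE {𝕜 Ω : Type*} [RCLike 𝕜] [MeasurableSpace Ω] (P : Measure Ω)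
    (x : ℝ → Ω → 𝕜) (T : ℝ) : Set ℝ≥0∞ :=
  {ζ | ∃ (G : ℝ → 𝕜) (y : ℝ → Ω → 𝕜), IsLinearReconstruction P x T G y ∧ ζ = nmse P x T y}

/-- The spectral expression
`1 - σ⁻² ∑_k ∫_{-fs/2}^{fs/2} |S(f - k fs)|² / (∑_{k'} S(f - k' fs)) df`,
with the convention `0 / 0 = 0` for the integrand. -/
noncomputable def spectralNMSE (σsq : ℝ) (S : ℝ → ℝ) (fs : ℝ) : ℝ :=
  1 - 1 / σsq * ∑' k : ℤ, ∫ f in (-(fs / 2))..(fs / 2),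
    |S (f - k * fs)| ^ 2 / ∑' k' : ℤ, S (f - k' * fs)

/-! The cardinal series reproduces `x`, so the filter `sinc (π fs t)` with output `x` itself has
zero error. Correlations are Fourier integrals of `S`, hence the mean-square error of a partial sum
is the integral of `S(f)` times the squared error of a trigonometric sum approximating `exp (2πi t
f)` (`IsPSD.integral_norm_sum_sq`). The coefficients `sinc (π (fs t - k))` are exactly the Fourier
coefficients of that exponential on the Nyquist interval, which carries `S`.

Since `S` is only integrable, L² convergence for Lebesgue measure does not yield convergence in
`L²(S)`. It does yield a.e. convergence along subsequences, and dominated convergence applies once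
the symmetric partial sums are uniformly bounded (`exists_norm_sum_sinc_mul_exp_le`). That bound
comes from pairing `k` with `-k`, which leaves an absolutely summable part and the bounded sums of
`sin (k x) / k`.

The spectral expression collapses because translates of `S` by nonzero multiples of `fs` vanish on
the open Nyquist interval. -/

/-! ### Bounded partial sums of the sawtooth series -/

theorem abs_sin_nat_mul_le (n : ℕ) (x : ℝ) : |Real.sin (n * x)| ≤ n * |Real.sin x| := by
  induction n with
  | zero => simp
  | succ n ih =>
    have e : Real.sin ((n + 1 : ℕ) * x)
        = Real.sin (n * x) * Real.cos x + Real.cos (n * x) * Real.sin x := by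
      rw [← Real.sin_add]; push_cast; ring_nf
    rw [e]
    refine (abs_add_le _ _).trans ?_
    rw [abs_mul, abs_mul]
    have h1 := mul_le_of_le_one_right (abs_nonneg (Real.sin (n * x))) (Real.abs_cos_le_one x)
    have h2 := mul_le_of_le_one_left (abs_nonneg (Real.sin x)) (Real.abs_cos_le_one (n * x))
    push_cast
    linarith

theorem abs_sin_le_two_mul_abs_sin_half (x : ℝ) : |Real.sin x| ≤ 2 * |Real.sin (x / 2)| := by
  have e : Real.sin x = 2 * Real.sin (x / 2) * Real.cos (x / 2) := by
    rw [← Real.sin_two_mul]; ring_nf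
  rw [e, abs_mul, abs_mul, abs_two]
  exact mul_le_of_le_one_right (by positivity) (Real.abs_cos_le_one _)

/-- The trivial bound for the partial sums of `∑ sin (k x) / k`, good for small `n`. -/
theorem abs_sum_sin_div_le (x : ℝ) (n : ℕ) :
    |∑ k ∈ Finset.range n, Real.sin ((k + 1) * x) / (k + 1)| ≤ 2 * |Real.sin (x / 2)| * n := by
  refine (Finset.abs_sum_le_sum_abs _ _).trans ?_
  have h : ∀ k ∈ Finset.range n,
      |Real.sin (((k : ℝ) + 1) * x) / (k + 1)| ≤ 2 * |Real.sin (x / 2)| := by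
    intro k _
    have hk : (0 : ℝ) < k + 1 := by positivity
    rw [abs_div, abs_of_pos hk, div_le_iff₀ hk]
    have h1 := abs_sin_nat_mul_le (k + 1) x
    push_cast at h1
    nlinarith [abs_sin_le_two_mul_abs_sin_half x]
  refine (Finset.sum_le_sum h).trans ?_
  simp [mul_comm]

/-- Summation by parts for the tails of `∑ sin (k x) / k`. -/
theorem abs_sum_Ico_sin_div_add_le (x : ℝ) {m n : ℕ} (hmn : m ≤ n) :
    |2 * Real.sin (x / 2) * ∑ k ∈ Finset.Ico m n, Real.sin ((k + 1) * x) / (k + 1)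
      + Real.cos ((n + 1 / 2) * x) / (n + 1)| ≤ 2 / (m + 1) - 1 / (n + 1) := by
  induction n, hmn using Nat.le_induction with
  | base =>
    have hm : (0 : ℝ) < m + 1 := by positivity
    simp only [Finset.Ico_self, Finset.sum_empty, mul_zero, zero_add]
    rw [abs_div, abs_of_pos hm, ← sub_div]
    gcongr
    linarith [Real.abs_cos_le_one ((m + 1 / 2) * x)]
  | succ n hmn ih =>
    have hn : (0 : ℝ) < n + 1 := by positivity
    have hn2 : (0 : ℝ) < n + 2 := by positivity
    have e : 2 * Real.sin (x / 2) * Real.sin ((n + 1) * x)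
        = Real.cos ((n + 1 / 2) * x) - Real.cos ((n + 1 + 1 / 2) * x) := by
      have e1 : (n + 1 / 2) * x = (n + 1) * x - x / 2 := by ring
      have e2 : (n + 1 + 1 / 2) * x = (n + 1) * x + x / 2 := by ring
      rw [e1, e2, Real.cos_sub, Real.cos_add]; ring
    rw [Finset.sum_Ico_succ_top hmn, mul_add]
    push_cast
    -- Keeping the boundary cosine inside the absolute value makes each step cost at most `1/(n+1) -
    -- 1/(n+2)`, which telescopes.
    have e3 : 2 * Real.sin (x / 2) * ∑ k ∈ Finset.Ico m n, Real.sin ((k + 1) * x) / (k + 1)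
          + 2 * Real.sin (x / 2) * (Real.sin ((n + 1) * x) / (n + 1))
          + Real.cos ((n + 1 + 1 / 2) * x) / (n + 1 + 1)
        = (2 * Real.sin (x / 2) * ∑ k ∈ Finset.Ico m n, Real.sin ((k + 1) * x) / (k + 1)
          + Real.cos ((n + 1 / 2) * x) / (n + 1))
          - Real.cos ((n + 1 + 1 / 2) * x) * (1 / (n + 1) - 1 / (n + 1 + 1)) := by
      rw [← mul_div_assoc, e]; ring
    rw [e3]
    refine (abs_sub _ _).trans ?_
    have hd : (0 : ℝ) ≤ 1 / (n + 1) - 1 / (n + 1 + 1) := by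
      rw [sub_nonneg]; gcongr; linarith
    rw [abs_mul, abs_of_nonneg hd]
    have := mul_le_of_le_one_left hd (Real.abs_cos_le_one ((n + 1 + 1 / 2) * x))
    linarith

/-- The partial sums of `∑ sin (k x) / k` are uniformly bounded. -/
theorem abs_sum_sin_div_le_three (x : ℝ) (n : ℕ) :
    |∑ k ∈ Finset.range n, Real.sin ((k + 1) * x) / (k + 1)| ≤ 3 := by
  rcases (abs_nonneg (Real.sin (x / 2))).eq_or_lt with h0 | hs
  · have := abs_sum_sin_div_le x n
    rw [← h0] at this
    linarith
  set s := |Real.sin (x / 2)| with hs_def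
  -- Splitting at `1/s` balances the bounds: the head is at most `2 s m ≤ 2`, the tail at most `1/(s
  -- (m+1)) ≤ 1`.
  set m := ⌊1 / s⌋₊ with hm_def
  have hm1 : (m : ℝ) ≤ 1 / s := Nat.floor_le (by positivity)
  have hm2 : 1 / s < m + 1 := Nat.lt_floor_add_one _
  rw [le_div_iff₀ hs] at hm1
  rw [div_lt_iff₀ hs] at hm2
  rcases le_total n m with hnm | hmn
  · have h1 := abs_sum_sin_div_le x n
    have h2 : (n : ℝ) ≤ m := by exact_mod_cast hnm
    nlinarith
  · rw [← Finset.sum_range_add_sum_Ico _ hmn]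
    refine (abs_add_le _ _).trans ?_
    have h1 := abs_sum_sin_div_le x m
    have h2 := abs_sum_Ico_sin_div_add_le x hmn
    set A := ∑ k ∈ Finset.Ico m n, Real.sin (((k : ℝ) + 1) * x) / (k + 1)
    have hn : (0 : ℝ) < n + 1 := by positivity
    have h3 : |Real.cos ((n + 1 / 2) * x) / (n + 1)| ≤ 1 / (n + 1) := by
      rw [abs_div, abs_of_pos hn]
      gcongr
      exact Real.abs_cos_le_one _
    have h4 : |2 * Real.sin (x / 2) * A| ≤ 2 / (m + 1) := by
      have := abs_sub (2 * Real.sin (x / 2) * A + Real.cos ((n + 1 / 2) * x) / (n + 1))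
        (Real.cos ((n + 1 / 2) * x) / (n + 1))
      rw [add_sub_cancel_right] at this
      linarith
    rw [abs_mul, abs_mul, abs_two, ← hs_def, le_div_iff₀ (by positivity)] at h4
    have h5 : |A| ≤ 1 := by nlinarith [abs_nonneg A]
    nlinarith

/-! ### Uniform bound for the Fourier sums with sinc coefficients -/

theorem Real.mul_sinc (x : ℝ) : x * Real.sinc x = Real.sin x := by
  rcases eq_or_ne x 0 with rfl | hx
  · simp
  · rw [Real.sinc_of_ne_zero hx]; field_simp

theorem sub_int_mul_sinc (u : ℝ) (k : ℤ) :
    (u - k) * Real.sinc (Real.pi * (u - k)) = (-1) ^ k * (Real.sin (Real.pi * u) / Real.pi) := by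
  have h := Real.mul_sinc (Real.pi * (u - k))
  have e : Real.sin (Real.pi * (u - k)) = (-1) ^ k * Real.sin (Real.pi * u) := by
    rw [mul_sub, mul_comm Real.pi (k : ℝ), Real.sin_sub_int_mul_pi]
  rw [e] at h
  rw [← mul_div_assoc, ← h]
  field_simp

/-- Writing `k = u - (u - k)` shows that the coefficients decay like `1/|k|`. -/
theorem abs_int_mul_sinc_le (u : ℝ) (k : ℤ) :
    |k * Real.sinc (Real.pi * (u - k))| ≤ |u| + 1 := by
  have h := sub_int_mul_sinc u k
  have e : k * Real.sinc (Real.pi * (u - k)) = u * Real.sinc (Real.pi * (u - k))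
      - (-1) ^ k * (Real.sin (Real.pi * u) / Real.pi) := by linear_combination -h
  rw [e]
  refine (abs_sub _ _).trans ?_
  have h1 : |u * Real.sinc (Real.pi * (u - k))| ≤ |u| := by
    rw [abs_mul]; exact mul_le_of_le_one_right (abs_nonneg _) (Real.abs_sinc_le_one _)
  have h2 : |(-1 : ℝ) ^ k * (Real.sin (Real.pi * u) / Real.pi)| ≤ 1 := by
    rw [abs_mul, abs_neg_one_zpow, one_mul, abs_div, abs_of_pos Real.pi_pos,
      div_le_one Real.pi_pos]
    linarith [Real.abs_sin_le_one (Real.pi * u), Real.pi_gt_three]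
  linarith

theorem sum_Icc_neg_eq_add_sum_range {M : Type*} [AddCommMonoid M] (f : ℤ → M) (N : ℕ) :
    ∑ k ∈ Finset.Icc (-(N : ℤ)) N, f k
      = f 0 + ∑ j ∈ Finset.range N, (f (j + 1) + f (-(j + 1))) := by
  induction N with
  | zero => simp
  | succ N ih =>
    have e : Finset.Icc (-((N + 1 : ℕ) : ℤ)) ((N + 1 : ℕ) : ℤ)
        = insert ((N : ℤ) + 1) (insert (-((N : ℤ) + 1)) (Finset.Icc (-(N : ℤ)) N)) := by
      ext k; simp only [Finset.mem_Icc, Finset.mem_insert]; omega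
    rw [e, Finset.sum_insert (by simp only [Finset.mem_Icc, Finset.mem_insert]; omega),
      Finset.sum_insert (by simp only [Finset.mem_Icc]; omega), ih, Finset.sum_range_succ]
    abel

open Complex in
-- Insert `1 = u/k - (u-k)/k` for `k` and its analogue for `-k`. The first parts are `O(1/k²)`; the
-- second combine into a sine, whose sign `(-1)^k` is absorbed by the shift `θ + π`.
theorem sinc_pair_eq (u θ : ℝ) (k : ℕ) (hk : k ≠ 0) :
    ((Real.sinc (Real.pi * (u - (k : ℤ))) : ℝ) : ℂ) * exp (((k : ℤ) : ℂ) * (θ * I))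
      + ((Real.sinc (Real.pi * (u - (-(k : ℤ) : ℤ))) : ℝ) : ℂ) *
        exp (((-(k : ℤ) : ℤ) : ℂ) * (θ * I))
    = (u / k : ℝ) * ((Real.sinc (Real.pi * (u - (k : ℤ))) : ℝ) * exp (((k : ℤ) : ℂ) * (θ * I))
        - (Real.sinc (Real.pi * (u - (-(k : ℤ) : ℤ))) : ℝ) *
          exp (((-(k : ℤ) : ℤ) : ℂ) * (θ * I)))
      - (2 * (Real.sin (Real.pi * u) / Real.pi) * (Real.sin (k * (θ + Real.pi)) / k) : ℝ) * I := by
  have h1 := sub_int_mul_sinc u k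
  have h2 := sub_int_mul_sinc u (-k)
  set a := Real.sinc (Real.pi * (u - (k : ℤ)))
  set b := Real.sinc (Real.pi * (u - (-(k : ℤ) : ℤ)))
  set σ := Real.sin (Real.pi * u) / Real.pi
  have hk' : (k : ℂ) ≠ 0 := by exact_mod_cast hk
  have e1 : Real.sin (k * (θ + Real.pi)) = (-1) ^ k * Real.sin (k * θ) := by
    rw [mul_add, Real.sin_add_nat_mul_pi]
  rw [e1]
  simp only [zpow_neg, zpow_natCast, Int.cast_neg, Int.cast_natCast] at h1 h2 ⊢
  have h3 : ((-1 : ℝ) ^ k)⁻¹ = (-1) ^ k := by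
    rcases neg_one_pow_eq_or ℝ k with h | h <;> rw [h] <;> norm_num
  rw [h3] at h2
  have h1' : ((u : ℂ) - k) * a = (-1) ^ k * σ := by exact_mod_cast h1
  have h2' : ((u : ℂ) - -k) * b = (-1) ^ k * σ := by exact_mod_cast h2
  have h4 : (2 : ℂ) * ((Real.sin (k * θ) : ℝ) : ℂ) * I
      = exp ((k : ℂ) * (θ * I)) - exp (-(k : ℂ) * (θ * I)) := by
    have := Complex.two_sin ((k * θ : ℝ) : ℂ)
    push_cast at this ⊢
    rw [this]
    have i2 := I_mul_I
    ring_nf at i2 ⊢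
    rw [i2]; ring
  push_cast at h4 ⊢
  generalize exp ((k : ℂ) * (θ * I)) = E at h4 ⊢
  generalize exp (-(k : ℂ) * (θ * I)) = E' at h4 ⊢
  field_simp
  linear_combination -E * h1' + E' * h2' + ((-1) ^ k * (σ : ℂ)) * h4

open Complex in
/-- The symmetric partial sums of the Fourier series with coefficients `sinc (π (u - k))` are
uniformly bounded. -/
theorem exists_norm_sum_sinc_mul_exp_le (u : ℝ) : ∃ C : ℝ, ∀ (N : ℕ) (θ : ℝ),
    ‖∑ k ∈ Finset.Icc (-(N : ℤ)) N,
      ((Real.sinc (Real.pi * (u - k)) : ℝ) : ℂ) * exp (k * (θ * I))‖ ≤ C := by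
  have hsum : Summable fun j : ℕ => 2 * (|u| * (|u| + 1)) * (1 / ((j : ℝ) + 1) ^ 2) := by
    refine Summable.mul_left _ ?_
    have := (summable_nat_add_iff 1).2 (Real.summable_one_div_nat_pow.2 (one_lt_two))
    simpa using this
  -- Term `k = 0`, absolutely summable part, and `6 = 2 * 1 * 3` from the sine sums.
  refine ⟨1 + (∑' j : ℕ, 2 * (|u| * (|u| + 1)) * (1 / ((j : ℝ) + 1) ^ 2)) + 6, fun N θ => ?_⟩
  have hexp : ∀ k : ℤ, ‖exp (k * (θ * I))‖ = 1 := fun k => by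
    have := norm_exp_ofReal_mul_I (k * θ)
    rw [← this]; push_cast; ring_nf
  rw [sum_Icc_neg_eq_add_sum_range]
  have hp : ∀ j ∈ Finset.range N, _ = _ := fun j _ => sinc_pair_eq u θ (j + 1) j.succ_ne_zero
  push_cast at hp
  push_cast
  rw [Finset.sum_congr rfl hp, Finset.sum_sub_distrib, ← Finset.sum_mul, ← Finset.mul_sum, ← add_sub_assoc]
  refine (norm_sub_le _ _).trans (add_le_add ((norm_add_le _ _).trans (add_le_add ?_ ?_)) ?_)
  · simpa using Real.abs_sinc_le_one _
  · refine (norm_sum_le _ _).trans (le_trans (Finset.sum_le_sum fun j _ => ?_)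
      (hsum.sum_le_tsum _ (fun j _ => by positivity)))
    have hb : ∀ k : ℤ, |(k : ℝ)| = j + 1 →
        ‖((Real.sinc (Real.pi * (u - k)) : ℝ) : ℂ) * exp (k * (θ * I))‖
          ≤ (|u| + 1) / (j + 1) := fun k hk => by
      rw [norm_mul, hexp, mul_one, norm_real, Real.norm_eq_abs, le_div_iff₀ (by positivity), ← hk,
        ← abs_mul, mul_comm]
      exact abs_int_mul_sinc_le u k
    have hj : (0 : ℝ) < j + 1 := by positivity
    have b1 := hb ((j : ℤ) + 1) (by push_cast; exact abs_of_pos hj)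
    have b2 := hb (-((j : ℤ) + 1)) (by push_cast; rw [abs_neg]; exact abs_of_pos hj)
    push_cast at b1 b2
    rw [norm_mul]
    have b3 : ‖(u : ℂ) / ((j : ℂ) + 1)‖ = |u| / (j + 1) := by
      rw [norm_div, norm_real, Real.norm_eq_abs]
      congr 1
      exact_mod_cast (norm_natCast (j + 1))
    rw [b3]
    calc _ ≤ |u| / (j + 1) * ((|u| + 1) / (j + 1) + (|u| + 1) / (j + 1)) := by
          gcongr
          exact (norm_sub_le _ _).trans (add_le_add b1 b2)
      _ = _ := by field_simp; ring
  · rw [norm_mul, norm_I, mul_one]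
    have := abs_sum_sin_div_le_three (θ + Real.pi) N
    have e : (2 * (Complex.sin (Real.pi * u) / Real.pi) * ∑ j ∈ Finset.range N,
        Complex.sin (((j : ℂ) + 1) * (θ + Real.pi)) / (j + 1))
        = ((2 * (Real.sin (Real.pi * u) / Real.pi) * ∑ k ∈ Finset.range N,
        Real.sin ((k + 1) * (θ + Real.pi)) / (k + 1) : ℝ) : ℂ) := by push_cast; rfl
    rw [e, norm_real, Real.norm_eq_abs, abs_mul, abs_mul, abs_two, abs_div, abs_of_pos Real.pi_pos]
    have h1 : |Real.sin (Real.pi * u)| / Real.pi ≤ 1 := by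
      rw [div_le_one Real.pi_pos]
      linarith [Real.abs_sin_le_one (Real.pi * u), Real.pi_gt_three]
    have h0 : 0 ≤ |Real.sin (Real.pi * u)| / Real.pi := by positivity
    nlinarith [abs_nonneg (∑ k ∈ Finset.range N, Real.sin (((k : ℝ) + 1) * (θ + Real.pi)) / (k + 1))]

/-! ### Convergence of Fourier series in `L²(S)` -/

/-- The symmetric partial sums of the Fourier series of a square integrable function on a circle
converge almost everywhere along a subsequence of any given subsequence. -/
theorem exists_subseq_fourier_tendsto_ae {T : ℝ} [hT : Fact (0 < T)] {f : AddCircle T → ℂ}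
    (hf : MemLp f 2 AddCircle.haarAddCircle) {ns : ℕ → ℕ} (hns : Tendsto ns atTop atTop) :
    ∃ ms : ℕ → ℕ, ∀ᵐ x ∂(AddCircle.haarAddCircle : Measure (AddCircle T)),
      Tendsto (fun n => ∑ k ∈ Finset.Icc (-(ns (ms n) : ℤ)) (ns (ms n)),
        fourierCoeff f k * fourier k x) atTop (𝓝 (f x)) := by
  have h1 : Tendsto (fun N : ℕ => Finset.Icc (-(N : ℤ)) N) atTop atTop :=
    tendsto_atTop_finset_of_monotone
      (fun a b hab => Finset.Icc_subset_Icc (by omega) (by omega))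
      (fun k => ⟨k.natAbs, by simp only [Finset.mem_Icc]; omega⟩)
  have h2 := (hasSum_fourier_series_L2 hf.toLp).comp (h1.comp hns)
  obtain ⟨ms, -, hms⟩ := (tendstoInMeasure_of_tendsto_Lp h2).exists_seq_tendsto_ae
  refine ⟨ms, ?_⟩
  have h3 : ∀ᵐ x ∂(AddCircle.haarAddCircle : Measure (AddCircle T)), ∀ k : ℤ,
      (fourierLp 2 k : Lp ℂ 2 (AddCircle.haarAddCircle : Measure (AddCircle T))) x
        = fourier k x := ae_all_iff.2 fun k => coeFn_fourierLp 2 k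
  have h4 : ∀ᵐ x ∂(AddCircle.haarAddCircle : Measure (AddCircle T)), ∀ s : Finset ℤ,
      (∑ k ∈ s, fourierCoeff f k • fourierLp 2 k :
        Lp ℂ 2 (AddCircle.haarAddCircle : Measure (AddCircle T))) x
        = ∑ k ∈ s, fourierCoeff f k * (fourierLp 2 k :
          Lp ℂ 2 (AddCircle.haarAddCircle : Measure (AddCircle T))) x := by
    refine ae_all_iff.2 fun s => ?_
    have h5 : ∀ᵐ x ∂(AddCircle.haarAddCircle : Measure (AddCircle T)), ∀ k : ℤ,
        (fourierCoeff f k • fourierLp 2 k :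
          Lp ℂ 2 (AddCircle.haarAddCircle : Measure (AddCircle T))) x
        = fourierCoeff f k * (fourierLp 2 k :
          Lp ℂ 2 (AddCircle.haarAddCircle : Measure (AddCircle T))) x :=
      ae_all_iff.2 fun k => by
        filter_upwards [Lp.coeFn_smul (fourierCoeff f k)
          (fourierLp 2 k : Lp ℂ 2 (AddCircle.haarAddCircle : Measure (AddCircle T)))] with x hx
        rw [hx, Pi.smul_apply, smul_eq_mul]
    filter_upwards [h5, Lp.coeFn_finsetSum s fun k => (fourierCoeff f k • fourierLp 2 k :
        Lp ℂ 2 (AddCircle.haarAddCircle : Measure (AddCircle T)))] with x hx hx'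
    rw [hx']
    simp [Finset.sum_apply, hx]
  filter_upwards [hms, h3, h4, hf.coeFn_toLp] with x hx hx3 hx4 hx5
  rw [hx5] at hx
  refine hx.congr fun n => ?_
  simp only [Function.comp_apply, fourierCoeff_congr_ae hf.coeFn_toLp]
  rw [hx4]
  simp_rw [hx3]

/-- The real-line form of `exists_subseq_fourier_tendsto_ae`. -/
theorem exists_subseq_fourierOn_tendsto_ae {T : ℝ} [hT : Fact (0 < T)] (a : ℝ) {f : ℝ → ℂ}
    (hf : MemLp f 2 (volume.restrict (Ioc a (a + T)))) {ns : ℕ → ℕ}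
    (hns : Tendsto ns atTop atTop) :
    ∃ ms : ℕ → ℕ, ∀ᵐ x : ℝ ∂volume.restrict (Ioc a (a + T)),
      Tendsto (fun n => ∑ k ∈ Finset.Icc (-(ns (ms n) : ℤ)) (ns (ms n)),
        ((1 / T) • ∫ y in a..(a + T), fourier (-k) (y : AddCircle T) • f y) *
          fourier k (x : AddCircle T)) atTop (𝓝 (f x)) := by
  obtain ⟨ms, hms⟩ := exists_subseq_fourier_tendsto_ae hf.memLp_liftIoc.haarAddCircle hns
  refine ⟨ms, ?_⟩
  have h1 := Measure.ae_smul_measure hms (ENNReal.ofReal T)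
  rw [← AddCircle.volume_eq_smul_haarAddCircle] at h1
  have h2 := (AddCircle.measurePreserving_mk T a).quasiMeasurePreserving.ae h1
  filter_upwards [h2, ae_restrict_mem measurableSet_Ioc] with x hx hxI
  rw [AddCircle.liftIoc_coe_apply hxI] at hx
  refine hx.congr fun n => Finset.sum_congr rfl fun k _ => ?_
  rw [fourierCoeff_liftIoc_eq, fourierCoeffOn_eq_integral, add_sub_cancel_left]

open Complex in
theorem exponential_fourierCoeff {B : ℝ} (hB : 0 < B) (t : ℝ) (k : ℤ) :
    (1 / B) • ∫ y in (-(B / 2))..(-(B / 2) + B),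
        fourier (-k) (y : AddCircle B) • exp (2 * Real.pi * t * y * I)
      = ((Real.sinc (Real.pi * (B * t - k)) : ℝ) : ℂ) := by
  have hB' : (B : ℂ) ≠ 0 := by exact_mod_cast hB.ne'
  set c : ℝ := 2 * Real.pi * (t - k / B) with hc
  have e1 : ∀ y : ℝ, fourier (-k) (y : AddCircle B) • exp (2 * Real.pi * t * y * I)
      = exp ((c * y : ℝ) * I) := by
    intro y
    rw [fourier_coe_apply, smul_eq_mul, ← exp_add, hc]
    congr 1
    push_cast
    field_simp
    ring
  simp_rw [e1]
  have e2 : -(B / 2) + B = B / 2 := by ring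
  rw [e2]
  rcases eq_or_ne c 0 with h0 | h0
  · have : Real.pi * (B * t - k) = 0 := by
      have : Real.pi * (B * t - k) = c * B / 2 := by rw [hc]; field_simp
      rw [this, h0]; simp
    rw [this, h0]
    simp
    field_simp
  · rw [intervalIntegral.integral_comp_mul_left (fun y : ℝ => exp (y * I)) h0, mul_neg,
      integral_exp_mul_I_eq_sinc]
    have : c * (B / 2) = Real.pi * (B * t - k) := by rw [hc]; field_simp
    have h0' : (c : ℂ) ≠ 0 := by exact_mod_cast h0
    rw [this, real_smul, real_smul, ← this]
    push_cast
    field_simp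

open Complex in
/-- For an integrable density `S` supported in the Nyquist interval, the symmetric partial sums of
the Fourier series of an exponential converge to it in `L²(S)`. -/
theorem tendsto_integral_mul_norm_exp_sub_sum_sq {S : ℝ → ℝ} (hS : Integrable S) {B : ℝ}
    (hB : 0 < B) (hsupp : ∀ f, B / 2 < |f| → S f = 0) (t : ℝ) :
    Tendsto (fun N : ℕ => ∫ f, S f * ‖exp (2 * Real.pi * t * f * I)
        - ∑ k ∈ Finset.Icc (-(N : ℤ)) N, ((Real.sinc (Real.pi * (B * t - k)) : ℝ) : ℂ)
          * exp (2 * Real.pi * (k / B) * f * I)‖ ^ 2) atTop (𝓝 0) := by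
  have : Fact (0 < B) := ⟨hB⟩
  obtain ⟨C, hC⟩ := exists_norm_sum_sinc_mul_exp_le (B * t)
  have hbd : ∀ (N : ℕ) (f : ℝ), ‖∑ k ∈ Finset.Icc (-(N : ℤ)) N,
      ((Real.sinc (Real.pi * (B * t - k)) : ℝ) : ℂ) * exp (2 * Real.pi * (k / B) * f * I)‖ ≤ C := by
    intro N f
    refine le_trans (le_of_eq ?_) (hC N (2 * Real.pi * f / B))
    congr 1
    refine Finset.sum_congr rfl fun k _ => ?_
    push_cast
    ring_nf
  have hexp : ∀ f : ℝ, ‖exp (2 * Real.pi * t * f * I)‖ = 1 := fun f => by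
    have := norm_exp_ofReal_mul_I (2 * Real.pi * t * f)
    push_cast at this
    exact this
  -- A.e. convergence is only available along subsequences, which suffices because the limit is
  -- always the same.
  refine tendsto_of_subseq_tendsto fun ns hns => ?_
  have hL2 : MemLp (fun f : ℝ => exp (2 * Real.pi * t * f * I)) 2
      (volume.restrict (Ioc (-(B / 2)) (-(B / 2) + B))) :=
    MemLp.of_bound (by fun_prop) 1 (ae_of_all _ fun f => (hexp f).le)
  obtain ⟨ms, hms⟩ := exists_subseq_fourierOn_tendsto_ae _ hL2 hns
  refine ⟨ms, ?_⟩
  rw [ae_restrict_iff' measurableSet_Ioc] at hms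
  rw [← integral_zero ℝ ℝ]
  refine tendsto_integral_of_dominated_convergence (fun f => ‖S f‖ * (1 + C) ^ 2)
    (fun n => hS.aestronglyMeasurable.mul (by fun_prop)) (hS.norm.mul_const _) (fun n => ?_) ?_
  · refine ae_of_all _ fun f => ?_
    rw [norm_mul, norm_pow, norm_norm]
    gcongr
    exact (norm_sub_le _ _).trans (add_le_add (hexp f).le (hbd _ f))
  -- The left endpoint lies neither in the `Ioc` nor in the region where `hsupp` applies.
  · have hne : ∀ᵐ f : ℝ, f ≠ -(B / 2) := by simp [ae_iff, measure_singleton]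
    filter_upwards [hms, hne] with f hf hfne
    rcases lt_or_ge (B / 2) |f| with h | h
    · simp [hsupp f h]
    · rw [abs_le] at h
      have h1 := hf ⟨lt_of_le_of_ne h.1 hfne.symm, by linarith⟩
      have h2 := (((tendsto_const_nhds (x := exp (2 * Real.pi * t * f * I))).sub h1).norm.pow 2).const_mul (S f)
      rw [sub_self, norm_zero, zero_pow two_ne_zero, mul_zero] at h2
      refine h2.congr fun n => ?_
      congr 4
      refine Finset.sum_congr rfl fun k _ => ?_
      rw [exponential_fourierCoeff hB, fourier_coe_apply]
      congr 2
      ring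

/-! ### Second moments in the spectral domain -/

theorem RCLike.norm_sum_ofReal_mul_sq {𝕜 ι : Type*} [RCLike 𝕜] (s : Finset ι) (c : ι → ℝ)
    (z : ι → 𝕜) : ‖∑ i ∈ s, (c i : 𝕜) * z i‖ ^ 2
      = ∑ i ∈ s, ∑ j ∈ s, c i * c j * RCLike.re (z i * conj (z j)) := by
  have h := RCLike.mul_conj (∑ i ∈ s, (c i : 𝕜) * z i)
  have h' := congrArg RCLike.re h
  rw [← RCLike.ofReal_pow, RCLike.ofReal_re] at h'
  rw [← h', map_sum, Finset.sum_mul_sum, map_sum]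
  refine Finset.sum_congr rfl fun i _ => ?_
  rw [map_sum]
  refine Finset.sum_congr rfl fun j _ => ?_
  rw [map_mul (starRingEnd 𝕜), RCLike.conj_ofReal, mul_mul_mul_comm, ← RCLike.ofReal_mul, RCLike.re_ofReal_mul]

theorem lintegral_enorm_sq_eq_ofReal_integral {E Ω : Type*} [NormedAddCommGroup E]
    [MeasurableSpace Ω] {P : Measure Ω} {g : Ω → E} (hg : MemLp g 2 P) :
    ∫⁻ ω, ‖g ω‖ₑ ^ 2 ∂P = ENNReal.ofReal (∫ ω, ‖g ω‖ ^ 2 ∂P) := by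
  rw [ofReal_integral_eq_lintegral_ofReal (by exact_mod_cast hg.integrable_norm_pow two_ne_zero)
    (ae_of_all _ fun ω => by positivity)]
  refine lintegral_congr fun ω => ?_
  rw [ENNReal.ofReal_pow (norm_nonneg _), ofReal_norm]

section WSS

variable {𝕜 Ω : Type*} [RCLike 𝕜] [MeasurableSpace Ω] {P : Measure Ω} {x : ℝ → Ω → 𝕜} {S : ℝ → ℝ}

theorem IsZeroMeanWSS.integrable_mul_conj (hx : IsZeroMeanWSS P x) (t s : ℝ) :
    Integrable (fun ω => x t ω * conj (x s ω)) P :=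
  (hx.memLp t).integrable_mul (hx.memLp s).star

/-- Real parts suffice because the filter is real; this treats `𝕜 = ℝ` and `𝕜 = ℂ` together. -/
theorem IsPSD.re_correlation_eq (hx : IsZeroMeanWSS P x) (hS : IsPSD P x S) (t s : ℝ) :
    RCLike.re (correlation P x t s) = ∫ f, S f * Real.cos (2 * Real.pi * f * (t - s)) := by
  have h1 := hx.stationary s 0 (t - s)
  rw [add_sub_cancel, zero_add] at h1
  have h2 := congrArg Complex.re (hS.autocorrelation_eq (t - s))
  have h3 : ∀ z : 𝕜, (scalarToComplex z).re = RCLike.re z := fun z => by simp [scalarToComplex]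
  rw [h3] at h2
  rw [h1, h2, Real.fourierInv_eq']
  have hint : Integrable (fun f : ℝ =>
      Complex.exp (↑(2 * Real.pi * inner ℝ f (t - s)) * Complex.I) • (S f : ℂ)) := by
    refine hS.integrable.ofReal.bdd_mul (c := 1) (by fun_prop) (ae_of_all _ fun f => ?_)
    rw [Complex.norm_exp_ofReal_mul_I]
  have h4 := integral_re hint
  simp only [RCLike.re_eq_complex_re] at h4
  rw [← h4]
  refine integral_congr_ae (ae_of_all _ fun f => ?_)
  simp only [smul_eq_mul, Complex.re_mul_ofReal, Complex.exp_ofReal_mul_I_re]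
  rw [mul_comm, RCLike.inner_apply, conj_trivial]
  ring_nf

theorem IsPSD.signalVariance_eq (hx : IsZeroMeanWSS P x) (hS : IsPSD P x S) :
    signalVariance P x = ∫ f, S f := by
  have h := hS.re_correlation_eq hx 0 0
  simp only [sub_zero, mul_zero, Real.cos_zero, mul_one] at h
  rw [← h, correlation, signalVariance, ← integral_re (hx.integrable_mul_conj 0 0)]
  refine integral_congr_ae (ae_of_all _ fun ω => ?_)
  simp only [RCLike.mul_conj]
  rw [← RCLike.ofReal_pow, RCLike.ofReal_re]

/-- The mean square of a finite real linear combination of values of the process, computed in the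
spectral domain. -/
theorem IsPSD.integral_norm_sum_sq (hx : IsZeroMeanWSS P x) (hS : IsPSD P x S) {ι : Type*}
    (s : Finset ι) (c τ : ι → ℝ) :
    ∫ ω, ‖∑ i ∈ s, (c i : 𝕜) * x (τ i) ω‖ ^ 2 ∂P
      = ∫ f, S f * ‖∑ i ∈ s, (c i : ℂ) * Complex.exp (2 * Real.pi * τ i * f * Complex.I)‖ ^ 2 := by
  have hcos : ∀ (i j : ι) (f : ℝ), RCLike.re (Complex.exp (2 * Real.pi * τ i * f * Complex.I) *
      conj (Complex.exp (2 * Real.pi * τ j * f * Complex.I)))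
      = Real.cos (2 * Real.pi * f * (τ i - τ j)) := fun i j f => by
    rw [← Complex.exp_conj, ← Complex.exp_add, RCLike.re_eq_complex_re,
      ← Complex.exp_ofReal_mul_I_re]
    congr 2
    simp only [map_mul, Complex.conj_ofReal, Complex.conj_I, Complex.conj_ofNat]
    push_cast
    ring
  have hint : ∀ i j, Integrable fun f => S f * Real.cos (2 * Real.pi * f * (τ i - τ j)) :=
    fun i j => hS.integrable.mul_bdd (c := 1) (by fun_prop)
      (ae_of_all _ fun f => Real.abs_cos_le_one _)
  have hL : ∀ ω, ‖∑ i ∈ s, (c i : 𝕜) * x (τ i) ω‖ ^ 2 = _ := fun ω =>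
    RCLike.norm_sum_ofReal_mul_sq s c fun i => x (τ i) ω
  have hR : ∀ f : ℝ,
      ‖∑ i ∈ s, (c i : ℂ) * Complex.exp (2 * Real.pi * τ i * f * Complex.I)‖ ^ 2 = _ := fun f =>
    RCLike.norm_sum_ofReal_mul_sq s c fun i => Complex.exp (2 * Real.pi * τ i * f * Complex.I)
  simp_rw [hL, hR, hcos, Finset.mul_sum, mul_left_comm (S _)]
  rw [integral_finsetSum _ fun i _ => integrable_finsetSum _ fun j _ =>
      (hx.integrable_mul_conj (τ i) (τ j)).re.const_mul _,
    integral_finsetSum _ fun i _ => integrable_finsetSum _ fun j _ => (hint i j).const_mul _]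
  refine Finset.sum_congr rfl fun i _ => ?_
  rw [integral_finsetSum _ fun j _ => (hx.integrable_mul_conj (τ i) (τ j)).re.const_mul _,
    integral_finsetSum _ fun j _ => (hint i j).const_mul _]
  refine Finset.sum_congr rfl fun j _ => ?_
  rw [integral_const_mul, integral_const_mul, integral_re (hx.integrable_mul_conj _ _),
    ← hS.re_correlation_eq hx]
  rfl

end WSS

/-! ### The sinc filter and exact reconstruction -/

theorem memLp_two_sinc_mul {a : ℝ} (ha : a ≠ 0) : MemLp (fun t => Real.sinc (a * t)) 2 volume := by
  have hm : Continuous fun t => Real.sinc (a * t) := Real.continuous_sinc.comp (by fun_prop)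
  rw [memLp_two_iff_integrable_sq hm.aestronglyMeasurable]
  have h : Integrable fun t : ℝ => Real.sinc t ^ 2 := by
    -- Both `sinc² t` and `t² sinc² t` are at most 1, so `sinc² t ≤ 2 / (1 + t²)`.
    refine (integrable_inv_one_add_sq.const_mul 2).mono'
      (Real.continuous_sinc.pow 2).aestronglyMeasurable (ae_of_all _ fun t => ?_)
    rw [Real.norm_of_nonneg (sq_nonneg _), ← div_eq_mul_inv, le_div_iff₀ (by positivity)]
    have h1 : Real.sinc t ^ 2 ≤ 1 := (sq_le_one_iff_abs_le_one _).2 (Real.abs_sinc_le_one t)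
    have h2 : (t * Real.sinc t) ^ 2 ≤ 1 := by
      rw [Real.mul_sinc]; exact Real.sin_sq_le_one t
    nlinarith
  exact h.comp_mul_left' ha

/-- Reconstruction of a bandlimited process from its samples by the cardinal series. -/
theorem IsPSD.isLinearReconstruction_sinc {𝕜 Ω : Type*} [RCLike 𝕜] [MeasurableSpace Ω]
    {P : Measure Ω} {x : ℝ → Ω → 𝕜} {S : ℝ → ℝ} (hx : IsZeroMeanWSS P x) (hS : IsPSD P x S)
    {fs : ℝ} (hfs : 0 < fs) (hsupp : ∀ f, fs / 2 < |f| → S f = 0) :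
    IsLinearReconstruction P x (1 / fs)
      (fun t => ((Real.sinc (Real.pi * fs * t) : ℝ) : 𝕜)) x where
  filter_memLp := (memLp_two_sinc_mul (by positivity)).ofReal
  output_memLp := hx.memLp
  tendsto t := by
    have hlim := (ENNReal.continuous_ofReal.tendsto _).comp
      (tendsto_integral_mul_norm_exp_sub_sum_sq hS.integrable hfs hsupp t)
    rw [ENNReal.ofReal_zero] at hlim
    refine hlim.congr fun N => ?_
    -- The error is one linear combination: `none` stands for `x(t)`, `some k` for the sample at `k
    -- / fs`.
    let c : Option ℤ → ℝ := fun o => o.elim 1 fun k => -Real.sinc (Real.pi * (fs * t - k))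
    let τ : Option ℤ → ℝ := fun o => o.elim t fun k => k / fs
    let s := Finset.insertNone (Finset.Icc (-(N : ℤ)) (N : ℤ))
    have h1 : ∀ ω, x t ω - partialReconstruction x (1 / fs)
        (fun t => ((Real.sinc (Real.pi * fs * t) : ℝ) : 𝕜)) N t ω
        = ∑ i ∈ s, (c i : 𝕜) * x (τ i) ω := fun ω => by
      have h2 : ∀ k : ℤ, Real.pi * fs * (t - k * (1 / fs)) = Real.pi * (fs * t - k) := fun k => by
        field_simp
      rw [partialReconstruction]
      simp only [h2]
      simp only [s, c, τ, Finset.sum_insertNone, Option.elim,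
        RCLike.ofReal_neg, RCLike.ofReal_one, one_mul, neg_mul, Finset.sum_neg_distrib,
        mul_one_div, sub_eq_add_neg]
    have h3 : MemLp (fun ω => ∑ i ∈ s, (c i : 𝕜) * x (τ i) ω) 2 P :=
      memLp_finsetSum _ fun i _ => (hx.memLp (τ i)).const_mul _
    simp_rw [h1]
    rw [lintegral_enorm_sq_eq_ofReal_integral h3, hS.integral_norm_sum_sq hx]
    simp only [Function.comp_apply, s, c, τ, Finset.sum_insertNone, Option.elim,
      Complex.ofReal_neg, Complex.ofReal_one, one_mul, neg_mul, Finset.sum_neg_distrib,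
      sub_eq_add_neg, Complex.ofReal_div, Complex.ofReal_intCast]

/-! ### Collapse of the spectral expression -/

theorem zero_of_nyquist_of_ne_zero {S : ℝ → ℝ} {fs : ℝ} (hfs : 0 < fs)
    (hsupp : ∀ f, fs / 2 < |f| → S f = 0) {f : ℝ} (hf : f ∈ Ioo (-(fs / 2)) (fs / 2)) {k : ℤ}
    (hk : k ≠ 0) : S (f - k * fs) = 0 := by
  refine hsupp _ ?_
  rcases lt_or_gt_of_ne hk with h | h
  · have h' : (k : ℝ) ≤ -1 := by exact_mod_cast Int.le_sub_one_of_lt h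
    refine lt_of_lt_of_le ?_ (le_abs_self _)
    nlinarith [hf.1]
  · have h' : (1 : ℝ) ≤ k := by exact_mod_cast h
    refine lt_of_lt_of_le ?_ (neg_le_abs _)
    nlinarith [hf.2]

theorem intervalIntegral_abs_sq_div_self {S : ℝ → ℝ} {fs : ℝ} (hfs : 0 < fs)
    (hsupp : ∀ f, fs / 2 < |f| → S f = 0) :
    ∫ f in (-(fs / 2))..(fs / 2), |S f| ^ 2 / S f = ∫ f, S f := by
  have h : ∀ f, |S f| ^ 2 / S f = S f := fun f => by rw [sq_abs, sq, mul_self_div_self]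
  simp_rw [h]
  rw [intervalIntegral.integral_of_le (by linarith), ← integral_Icc_eq_integral_Ioc]
  refine setIntegral_eq_integral_of_forall_compl_eq_zero fun f hf => hsupp f ?_
  rwa [mem_Icc, ← abs_le, not_le] at hf

theorem spectralNMSE_eq_zero {S : ℝ → ℝ} {fs σsq : ℝ} (hfs : 0 < fs)
    (hsupp : ∀ f, fs / 2 < |f| → S f = 0) (hσ : σsq ≠ 0) (hσS : ∫ f, S f = σsq) :
    spectralNMSE σsq S fs = 0 := by
  have hle : -(fs / 2) ≤ fs / 2 := by linarith
  have h0 : ∀ k : ℤ, k ≠ 0 → ∫ f in (-(fs / 2))..(fs / 2),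
      |S (f - k * fs)| ^ 2 / ∑' k' : ℤ, S (f - k' * fs) = 0 := fun k hk => by
    rw [← intervalIntegral.integral_zero (μ := volume) (a := -(fs / 2)) (b := fs / 2)]
    refine intervalIntegral.integral_congr_Ioo_of_le hle fun f hf => ?_
    -- The open interval is essential: at `f = fs/2`, `k = 1` the shifted argument is `-fs/2`, where
    -- `S` may be nonzero.
    simp [zero_of_nyquist_of_ne_zero hfs hsupp hf hk]
  have h1 : ∫ f in (-(fs / 2))..(fs / 2),
      |S (f - (0 : ℤ) * fs)| ^ 2 / ∑' k' : ℤ, S (f - k' * fs) = σsq := by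
    rw [← hσS, ← intervalIntegral_abs_sq_div_self hfs hsupp]
    refine intervalIntegral.integral_congr_Ioo_of_le hle fun f hf => ?_
    rw [tsum_eq_single 0 fun k hk => zero_of_nyquist_of_ne_zero hfs hsupp hf hk]
    simp
  rw [spectralNMSE, tsum_eq_single 0 h0, h1, one_div_mul_cancel hσ, sub_self]

theorem corollary1 {𝕜 Ω : Type*} [RCLike 𝕜] [MeasurableSpace Ω] (P : Measure Ω)
    [IsProbabilityMeasure P] (x : ℝ → Ω → 𝕜) (S : ℝ → ℝ) (fm fs : ℝ)
    (hx : IsZeroMeanWSS P x) (hσ : 0 < signalVariance P x) (hS : IsPSD P x S)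
    (hband : IsBandlimited S fm) (hfs : 0 < fs) (hNyquist : 2 * fm ≤ fs) :
    -- the minimal NMSE of linear reconstruction is zero
    IsLeast (achievableNMSE P x (1 / fs)) 0 ∧
    -- only the terms with index zero survive in the spectral expression
    (∀ f ∈ Ioo (-(fs / 2)) (fs / 2), ∀ k : ℤ, k ≠ 0 → S (f - k * fs) = 0) ∧
    (∫ f in (-(fs / 2))..(fs / 2), |S f| ^ 2 / S f) = signalVariance P x ∧
    -- the spectral expression of the minimal NMSE is zero
    spectralNMSE (signalVariance P x) S fs = 0 := by
  have hsupp : ∀ f, fs / 2 < |f| → S f = 0 := fun f hf => hband f (by linarith)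
  have hvar := hS.signalVariance_eq hx
  refine ⟨⟨⟨_, x, hS.isLinearReconstruction_sinc hx hfs hsupp, by simp [nmse]⟩,
      fun _ _ => zero_le⟩,
    fun f hf k hk => zero_of_nyquist_of_ne_zero hfs hsupp hf hk,
    (intervalIntegral_abs_sq_div_self hfs hsupp).trans hvar.symm,
    spectralNMSE_eq_zero hfs hsupp hσ.ne' hvar.symm⟩
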